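/- Let $m\ge 2$. For every $\eta>0$ there is $\delta>0$, depending only on $\eta$ and $m$, such that the following holds. Let $k\ge 1$ and let $$\epsilon_{i1}x_1+\cdots+\epsilon_{im}x_m=0\qquad(i=1,\dots,k)$$ be a system of linear equations with coefficients $\epsilon_{ij}\in\{-1,0,1\}$ that is graph-representable (defined below). Let $G$ be a finite abelian group of order $N$ and let $A_1,\dots,A_m\subseteq G$. If the system has fewer than $\delta N^{m-k}$ solutions in $G$ with $x_j\in A_j$ for all $j$, then there are subsets $A_j'\subseteq A_j$ with $|A_j\setminus A_j'|\le\eta N$ for all $j$ such that the system has no solution with $x_j\in A_j'$ for all $j$. (In short: if there are $o(N^{m-k})$ solutions, then removing $o(N)$ elements from each $A_j$ eliminates all solutions.) Here the system is graph-representable if there is a finite directed graph $H$ with $m$ arcs (loops and multiple arcs allowed), one associated with each variable $x_j$, such that the vectors $(\epsilon_{i1},\dots,\epsilon_{im})$, $i=1,\dots,k$, integrally generate the cycle space of $H$: they lie in the cycle space, are linearly independent, and the characteristic vector of every cycle of $H$ is a linear combination of them with integer coefficients. The cycles of $H$ may traverse arcs in either direction; the characteristic vector of a cycle has $j$-th coordinate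 $+1$, $-1$ or $0$ according to whether the $j$-th arc is traversed in its direction, traversed in the reverse direction, or not traversed; and the cycle space of $H$ is the vector space over $\mathbb Q$ spanned by the characteristic vectors of its cycles. -/

import Mathlib

/-- A directed graph with vertex set `V` and `m` arcs, one for each index in `Fin m`
(loops and parallel or antiparallel arcs are allowed). -/
structure ArcDigraph (V : Type) (m : ℕ) where
  /-- the initial vertex of each arc -/
  src : Fin m → V
  /-- the terminal vertex of each arc -/
  tgt : Fin m → V

namespace ArcDigraph

variable {V : Type} {m : ℕ}

/-- A cycle of length `len + 1`: pairwise distinct vertices `vert 0, …, vert len` and pairwise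
distinct arcs, where `arc t` joins `vert t` to the cyclically next vertex `vert (t + 1)` and is
traversed in its direction if `fwd t` is true, and in the reverse direction otherwise.
(The index `t + 1` is taken modulo `len + 1`.) -/
structure Cycle (H : ArcDigraph V m) where
  len : ℕ
  vert : Fin (len + 1) → V
  arc : Fin (len + 1) → Fin m
  fwd : Fin (len + 1) → Bool
  vert_injective : Function.Injective vert
  arc_injective : Function.Injective arc
  step_fwd : ∀ t, fwd t = true → H.src (arc t) = vert t ∧ H.tgt (arc t) = vert (t + 1)
  step_bwd : ∀ t, fwd t = false → H.tgt (arc t) = vert t ∧ H.src (arc t) = vert (t + 1)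

/-- The characteristic vector of a cycle: `+1` on arcs traversed in their direction, `-1` on arcs
traversed in the reverse direction, `0` on arcs that are not traversed. -/
def Cycle.charVec {H : ArcDigraph V m} (C : H.Cycle) : Fin m → ℤ :=
  fun i => ∑ t, if C.arc t = i then (if C.fwd t = true then 1 else -1) else 0

/-- An integer vector, seen as a rational vector. -/
def ratVec (v : Fin m → ℤ) : Fin m → ℚ := fun i => (v i : ℚ)

/-- The cycle space: the rational vector space spanned by the characteristic vectors of cycles. -/
def cycleSpace (H : ArcDigraph V m) : Submodule ℚ (Fin m → ℚ) :=
  Submodule.span ℚ (Set.range fun C : H.Cycle => ratVec C.charVec)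

/-- The integer vectors `v 0, …, v (k - 1)` integrally generate the cycle space of `H`: they lie
in the cycle space, they are linearly independent, and the characteristic vector of every cycle
is a linear combination of them with integer coefficients. -/
structure IntegrallyGenerates {k : ℕ} (v : Fin k → Fin m → ℤ) (H : ArcDigraph V m) : Prop where
  mem_cycleSpace : ∀ i, ratVec (v i) ∈ H.cycleSpace
  linearIndependent : LinearIndependent ℚ fun i => ratVec (v i)
  charVec_mem_span : ∀ C : H.Cycle, C.charVec ∈ Submodule.span ℤ (Set.range v)

end ArcDigraph

/-- The system of `k` equations in `m` variables with coefficients `c i j` is graph-representable: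
there is a (finite) directed graph with `m` arcs, the `j`-th arc being associated with the `j`-th
variable, whose cycle space is integrally generated by the rows of `c`. -/
def GraphRepresentable {k m : ℕ} (c : Fin k → Fin m → ℤ) : Prop :=
  ∃ (V : Type) (_ : Finite V) (H : ArcDigraph V m), ArcDigraph.IntegrallyGenerates c H

/-- The solutions `x` of the homogeneous system with coefficients `c i j` such that `x j ∈ A j`
for every `j`. -/
def systemSolutions {k m : ℕ} (c : Fin k → Fin m → ℤ) {G : Type*} [AddCommGroup G]
    (A : Fin m → Set G) : Set (Fin m → G) :=
  {x | (∀ i, ∑ j, c i j • x j = 0) ∧ ∀ j, x j ∈ A j}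

/-!
The solutions of a graph-representable system are the potential differences of the digraph `H`:
`x j = p (tgt j) - p (src j)` for some function `p` from the vertices to `G`. Indeed a vector that
sums to zero along every cycle has a potential (`ArcDigraph.exists_potential`), and the equations
integrally generate all cycle conditions; conversely the equations lie in the cycle space, which is
orthogonal to potential differences
(`ArcDigraph.IntegrallyGenerates.forall_sum_smul_eq_zero_iff`).

So solutions with `x j ∈ A j` correspond to homomorphisms `v ↦ (v, p v)` of `H` into the graph on
copies of `G`, one for each vertex of `H`, in which arc `j` carries the pairs `(g, g + a)` with
`a ∈ A j`. A potential is determined by its differences up to a constant on each component, and a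
count of dimensions over `ℚ` (`ArcDigraph.add_card_connectedComponent_le`) bounds the number of
components, so few solutions means few homomorphisms. The partite graph removal lemma
(`exists_partite_graph_removal`) then destroys all of them by deleting few edges. Removing from
`A j` the elements that lose at least a `1 / m`-fraction of their `|G|` edges
(`exists_subsets_without_solutions`) leaves no solution: all `|G|` translates of its potential would
use a deleted edge, while each of the `m` arcs accounts for fewer than `|G| / m` translates.

Parallel arcs are merged by intersecting their conditions, loops merely say that a variable
vanishes, and only the at most `2 * m` ends of arcs matter, so that `δ` depends on `m` and `η` only.

The removal lemma follows from Szemerédi's regularity lemma applied to the whole graph, whose parts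
need not respect the copies of `G`. Besides the edges in irregular or sparse pairs or inside a part,
one deletes the edges at vertices whose copy of `G` meets their part in a small proportion. Any
surviving homomorphism then lies in regular dense pairs in which the pieces of the relevant copies
are large, and the counting lemma `card_filter_forall_rel_ge` gives many homomorphisms.
-/

open Finset

/-! ### Counting homomorphisms along regular pairs -/

/-- Resampling one coordinate uniformly preserves the average of `f`. -/
theorem sum_sum_update {W : Type*} [Fintype W] [DecidableEq W] {Y : W → Type*}
    [∀ w, Fintype (Y w)] (u : W) (f : (∀ w, Y w) → ℝ) :
    ∑ q, ∑ x : Y u, f (Function.update q u x) = Fintype.card (Y u) * ∑ q, f q := by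
  -- `(q, x) ↦ (update q u x, q u)` is an involution of the index set
  have hinv : Function.Involutive
      (fun z : (∀ w, Y w) × Y u => (Function.update z.1 u z.2, z.1 u)) := by
    rintro ⟨q, x⟩
    simp
  rw [← Fintype.sum_prod_type' (fun q (x : Y u) => f (Function.update q u x)),
    ← Equiv.sum_comp (Function.Involutive.toPerm _ hinv)]
  have : ∀ z : (∀ w, Y w) × Y u,
      f (Function.update (Function.Involutive.toPerm _ hinv z).1 u
        (Function.Involutive.toPerm _ hinv z).2) = f z.1 := by
    rintro ⟨q, x⟩
    simp [Function.Involutive.toPerm]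
  simp_rw [this]
  rw [Fintype.sum_prod_type, mul_sum]
  simp

open Classical in
/-- **Counting lemma.** If, for every pair in `F`, the relation `R` has at least its expected share
of pairs of density `d` between any two subsets, up to an error `ε`, then the number of choices
`q` satisfying all the relations in `F` is at least the expected one, up to an error `ε` for each
pair in `F`. -/
theorem card_filter_forall_rel_ge {W : Type*} [Fintype W] [LinearOrder W] {Y : W → Type*}
    [∀ w, Fintype (Y w)] (R : ∀ u v, Y u → Y v → Prop) {d ε : ℝ} (hd0 : 0 ≤ d) (hd1 : d ≤ 1)
    (hε : 0 ≤ ε) (F : Finset (W × W)) (hF : ∀ e ∈ F, e.1 < e.2)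
    (hR : ∀ e ∈ F, ∀ (S : Finset (Y e.1)) (T : Finset (Y e.2)),
      d * (#S * #T) - ε * (Fintype.card (Y e.1) * Fintype.card (Y e.2)) ≤
        #{z ∈ S ×ˢ T | R e.1 e.2 z.1 z.2}) :
    (d ^ #F - #F * ε) * ∏ w, (Fintype.card (Y w) : ℝ) ≤
      #{q : ∀ w, Y w | ∀ e ∈ F, R e.1 e.2 (q e.1) (q e.2)} := by
  induction F using Finset.induction_on with
  | empty => simp
  | insert e F heF ih =>
    obtain ⟨u, v⟩ := e
    have ih := ih (fun e he => hF e (mem_insert_of_mem he))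
      (fun e he => hR e (mem_insert_of_mem he))
    have huv : u < v := hF _ (mem_insert_self _ _)
    have hR' := hR _ (mem_insert_self _ _)
    have hFlt : ∀ e ∈ F, e.1 < e.2 := fun e he => hF e (mem_insert_of_mem he)
    set M : ℝ := ∏ w, (Fintype.card (Y w) : ℝ) with hM
    have hM0 : 0 ≤ M := prod_nonneg fun _ _ => by positivity
    by_cases hY : ∃ w, IsEmpty (Y w)
    · obtain ⟨w, hw⟩ := hY
      have : M = 0 := prod_eq_zero (mem_univ w) (by simp)
      rw [this, mul_zero]
      positivity
    simp only [not_exists, not_isEmpty_iff] at hY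
    have hMcard : M = ∑ _q : ∀ w, Y w, (1 : ℝ) := by
      simp [hM, Fintype.card_pi]
    let A : (∀ w, Y w) → Prop := fun q => ∀ e ∈ F, R e.1 e.2 (q e.1) (q e.2)
    let B : (∀ w, Y w) → Prop := fun q => R u v (q u) (q v)
    have hu : (0 : ℝ) < Fintype.card (Y u) := by exact_mod_cast Fintype.card_pos
    have hv : (0 : ℝ) < Fintype.card (Y v) := by exact_mod_cast Fintype.card_pos
    -- averaging over the coordinates `u` and `v`
    have havg : ∀ f : (∀ w, Y w) → ℝ,
        ∑ q, ∑ x : Y u, ∑ y : Y v, f (Function.update (Function.update q u x) v y) =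
          Fintype.card (Y u) * (Fintype.card (Y v) * ∑ q, f q) := by
      intro f
      rw [sum_sum_update u (fun q => ∑ y : Y v, f (Function.update q v y)), sum_sum_update]
    have hstep : d * (#{q | A q} : ℝ) - ε * M ≤ #{q | A q ∧ B q} := by
      have hsum : ∀ (P : (∀ w, Y w) → Prop) [DecidablePred P],
          (#{q | P q} : ℝ) = ∑ q, if P q then 1 else 0 := by
        intro P _; simp
      rw [hsum, hsum, hMcard, mul_sum, mul_sum, ← sum_sub_distrib]
      refine le_of_mul_le_mul_left ?_ (mul_pos hu hv)
      rw [mul_assoc, mul_assoc, ← havg, ← havg]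
      refine sum_le_sum fun q _ => ?_
      -- with all other coordinates fixed, the constraints in `F` say that `(x, y) ∈ S ×ˢ T`
      let S : Finset (Y u) := {x | ∀ e ∈ F, e.1 ≠ v → e.2 ≠ v →
        R e.1 e.2 (Function.update q u x e.1) (Function.update q u x e.2)}
      let T : Finset (Y v) := {y | ∀ e ∈ F, ¬ (e.1 ≠ v ∧ e.2 ≠ v) →
        R e.1 e.2 (Function.update q v y e.1) (Function.update q v y e.2)}
      have hA : ∀ x y, A (Function.update (Function.update q u x) v y) ↔ x ∈ S ∧ y ∈ T := by
        intro x y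
        simp only [A, S, T, mem_filter, mem_univ, true_and]
        have h1 : ∀ w, w ≠ v → Function.update (Function.update q u x) v y w =
            Function.update q u x w := fun w hw => Function.update_of_ne hw _ _
        have h2 : ∀ w, w ≠ u → Function.update (Function.update q u x) v y w =
            Function.update q v y w := by
          intro w hw
          rw [Function.update_comm huv.ne]
          exact Function.update_of_ne hw _ _
        have h3 : ∀ e ∈ F, ¬ (e.1 ≠ v ∧ e.2 ≠ v) → e.1 ≠ u ∧ e.2 ≠ u := by
          rintro ⟨a, b⟩ he hv
          have hab := hFlt _ he
          simp only at hab hv ⊢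
          refine ⟨?_, ?_⟩
          · rintro rfl
            apply hv
            refine ⟨huv.ne, ?_⟩
            rintro rfl
            exact heF he
          · rintro rfl
            exact hv ⟨(hab.trans huv).ne, huv.ne⟩
        constructor
        · intro h
          refine ⟨fun e he hv1 hv2 => ?_, fun e he hv => ?_⟩
          · rw [← h1 _ hv1, ← h1 _ hv2]; exact h e he
          · rw [← h2 _ (h3 e he hv).1, ← h2 _ (h3 e he hv).2]; exact h e he
        · rintro ⟨hS, hT⟩ e he
          by_cases hv : e.1 ≠ v ∧ e.2 ≠ v
          · rw [h1 _ hv.1, h1 _ hv.2]; exact hS e he hv.1 hv.2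
          · rw [h2 _ (h3 e he hv).1, h2 _ (h3 e he hv).2]; exact hT e he hv
      have hB : ∀ x y, B (Function.update (Function.update q u x) v y) ↔ R u v x y := by
        intro x y
        simp only [B]
        rw [Function.update_self, Function.update_of_ne huv.ne, Function.update_self]
      have hST := hR' S T
      simp only at hST
      have e1 : ∑ x : Y u, ∑ y : Y v, (if x ∈ S ∧ y ∈ T then (1 : ℝ) else 0) = #S * #T := by
        rw [← Nat.cast_mul, ← card_product, ← Fintype.sum_prod_type'
          (fun x y => if x ∈ S ∧ y ∈ T then (1 : ℝ) else 0)]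
        rw [sum_boole]
        congr 2
        ext z
        simp
      have e2 : ∑ x : Y u, ∑ y : Y v, (if (x ∈ S ∧ y ∈ T) ∧ R u v x y then (1 : ℝ) else 0) =
          #{z ∈ S ×ˢ T | R u v z.1 z.2} := by
        rw [← Fintype.sum_prod_type'
          (fun x y => if (x ∈ S ∧ y ∈ T) ∧ R u v x y then (1 : ℝ) else 0)]
        rw [sum_boole]
        congr 2
        ext z
        simp
      simp_rw [hA, hB, e2]
      refine le_trans (le_of_eq ?_) hST
      rw [← e1]
      simp only [mul_sum, sum_sub_distrib]
      simp [mul_comm, mul_left_comm]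
    have hcard : #{q : ∀ w, Y w | ∀ e ∈ insert (u, v) F, R e.1 e.2 (q e.1) (q e.2)} =
        #{q | A q ∧ B q} := by
      congr 1
      ext q
      simp [A, B, and_comm]
    rw [hcard, card_insert_of_notMem heF]
    refine le_trans ?_ hstep
    have h5 : d * ((d ^ #F - #F * ε) * M) ≤ d * (#{q | A q} : ℝ) :=
      mul_le_mul_of_nonneg_left ih hd0
    have h6 : d * (#F * ε * M) ≤ 1 * (#F * ε * M) :=
      mul_le_mul_of_nonneg_right hd1 (by positivity)
    push_cast
    rw [pow_succ]
    nlinarith [h5, h6]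

/-- In an `ε`-uniform pair of density at least `d`, any two subsets span at least `d` times the
maximal number of edges, up to an error `ε #s #t`; no lower bound on the subsets is needed. -/
theorem SimpleGraph.IsUniform.le_card_interedges {α : Type*} {G : SimpleGraph α}
    [DecidableRel G.Adj] {ε d : ℝ} {s t : Finset α} (h : G.IsUniform ε s t)
    (hd : d ≤ G.edgeDensity s t) {S T : Finset α} (hS : S ⊆ s) (hT : T ⊆ t) :
    d * (#S * #T) - ε * (#s * #t) ≤ #(G.interedges S T) := by
  have hε := h.pos
  have hd1 : d ≤ 1 := hd.trans (by exact_mod_cast G.edgeDensity_le_one s t)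
  have hSs : (#S : ℝ) ≤ #s := by exact_mod_cast card_le_card hS
  have hTt : (#T : ℝ) ≤ #t := by exact_mod_cast card_le_card hT
  have hST0 : (0 : ℝ) ≤ #S * #T := by positivity
  have hdST : d * (#S * #T : ℝ) ≤ #S * #T := by nlinarith
  by_cases h1 : (#s : ℝ) * ε ≤ #S
  · by_cases h2 : (#t : ℝ) * ε ≤ #T
    · have h3 := (abs_lt.1 (h hS hT h1 h2)).1
      have h4 : (#(G.interedges S T) : ℝ) = G.edgeDensity S T * (#S * #T) := by
        rcases eq_or_ne (#S * #T : ℝ) 0 with h0 | h0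
        · have := G.card_interedges_le_mul S T
          have : (#(G.interedges S T) : ℝ) ≤ #S * #T := by exact_mod_cast this
          rw [h0] at this ⊢
          linarith
        · rw [← G.card_interedges_div_card]
          push_cast
          rw [div_mul_cancel₀ _ h0]
      have h5 : (#S * #T : ℝ) ≤ #s * #t := by gcongr
      rw [h4]
      nlinarith
    · have : (#S * #T : ℝ) ≤ #s * (#t * ε) := by gcongr; linarith
      nlinarith
  · have : (#S * #T : ℝ) ≤ #s * ε * #t := by gcongr; linarith
    nlinarith

/-! ### A partite graph removal lemma -/

/-- The edges destroyed by passing to the reduced graph lie in irregular pairs, inside a part, or in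
sparse pairs, so there are few of them. -/
theorem card_filter_adj_not_regularityReduced_le {α : Type*} [Fintype α] [DecidableEq α]
    [Nonempty α] (G : SimpleGraph α) [DecidableRel G.Adj]
    {P : Finpartition (univ : Finset α)} (hP : P.IsEquipartition)
    {ε d θ : ℝ} (hε : 0 < ε) (hd : 0 ≤ d) (hθ : 0 < θ) (hPε : P.IsUniform G ε)
    (hPθ : 4 / θ ≤ #P.parts) :
    (#{z : α × α | G.Adj z.1 z.2 ∧ ¬ (G.regularityReduced P ε d).Adj z.1 z.2} : ℝ) ≤
      (4 * ε + θ / 2 + 4 * d) * (Fintype.card α : ℝ) ^ 2 := by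
  let A := (P.nonUniforms G ε).biUnion fun z => z.1 ×ˢ z.2
  let B := P.parts.biUnion offDiag
  let C := (P.sparsePairs G d).biUnion fun z => G.interedges z.1 z.2
  have hsub : ({z : α × α | G.Adj z.1 z.2 ∧ ¬ (G.regularityReduced P ε d).Adj z.1 z.2} : Finset _)
      ⊆ A ∪ B ∪ C := by
    rintro ⟨x, y⟩ hz
    simp only [mem_filter, mem_univ, true_and] at hz
    obtain ⟨h, h'⟩ := hz
    obtain ⟨U, hU, hx⟩ := P.exists_mem (mem_univ x)
    obtain ⟨V, hV, hy⟩ := P.exists_mem (mem_univ y)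
    simp only [A, B, C, mem_union, mem_biUnion]
    by_cases hUV : U = V
    · subst hUV
      exact Or.inl (Or.inr ⟨U, hU, mem_offDiag.2 ⟨hx, hy, G.ne_of_adj h⟩⟩)
    by_cases hu : G.IsUniform ε U V
    · refine Or.inr ⟨(U, V), ?_, ?_⟩
      · rw [Finpartition.mk_mem_sparsePairs]
        refine ⟨hU, hV, hUV, not_le.1 fun hdens => h' ?_⟩
        exact ⟨h, U, hU, V, hV, hx, hy, hUV, hu, hdens⟩
      · exact (SimpleGraph.mk_mem_interedges_iff _).2 ⟨hx, hy, h⟩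
    · refine Or.inl (Or.inl ⟨(U, V), ?_, mem_product.2 ⟨hx, hy⟩⟩)
      rw [Finpartition.mk_mem_nonUniforms]
      exact ⟨hU, hV, hUV, hu⟩
  have hA : (#A : ℝ) < 4 * ε * #(univ : Finset α) ^ 2 :=
    hP.sum_nonUniforms_lt univ_nonempty hε hPε
  have hB : (#B : ℝ) ≤ θ / 2 * #(univ : Finset α) ^ 2 := hP.card_biUnion_offDiag_le hθ hPθ
  have hC : (#C : ℝ) ≤ 4 * d * #(univ : Finset α) ^ 2 :=
    hP.card_interedges_sparsePairs_le (G := G) hd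
  rw [card_univ] at hA hB hC
  have h1 : (#(A ∪ B ∪ C) : ℝ) ≤ #A + #B + #C := by
    have h1 := card_union_le (A ∪ B) C
    have h2 := card_union_le A B
    exact_mod_cast h1.trans (by omega)
  have h2 := card_le_card hsub
  calc _ ≤ (#(A ∪ B ∪ C) : ℝ) := by exact_mod_cast h2
    _ ≤ _ := h1
    _ ≤ _ := by nlinarith

/-- Few vertices lie in a piece `{b ∈ s | f b = u}` filling less than an `r`-fraction of its
part `s`. -/
theorem card_small_fibers_le {α W : Type*} [Fintype α] [DecidableEq α] [Fintype W]
    [DecidableEq W]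
    (P : Finpartition (univ : Finset α)) (f : α → W) {r : ℝ}
    (hr : 0 ≤ r) :
    (#{a : α | (#{b ∈ P.part a | f b = f a} : ℝ) < r * #(P.part a)} : ℝ) ≤
      r * Fintype.card W * Fintype.card α := by
  let D : Finset α := {a : α | (#{b ∈ P.part a | f b = f a} : ℝ) < r * #(P.part a)}
  have hsub : D ⊆ P.parts.biUnion fun s => univ.biUnion fun u =>
      if (#{b ∈ s | f b = u} : ℝ) < r * #s then {b ∈ s | f b = u} else ∅ := by
    intro a ha
    simp only [D, mem_filter, mem_univ, true_and] at ha
    simp only [mem_biUnion, mem_univ, true_and]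
    refine ⟨P.part a, P.part_mem.2 (mem_univ a), f a, ?_⟩
    rw [if_pos ha]
    exact mem_filter.2 ⟨P.mem_part (mem_univ a), rfl⟩
  have h1 : (#D : ℝ) ≤ ∑ s ∈ P.parts, ∑ _u : W, r * #s := by
    refine (Nat.cast_le.2 ((card_le_card hsub).trans card_biUnion_le)).trans ?_
    push_cast
    refine sum_le_sum fun s _ => ?_
    refine (Nat.cast_le.2 card_biUnion_le).trans ?_
    push_cast
    refine sum_le_sum fun u _ => ?_
    split_ifs with h
    · exact h.le
    · simp only [card_empty, Nat.cast_zero]; positivity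
  refine h1.trans (le_of_eq ?_)
  have h2 : (∑ s ∈ P.parts, (#s : ℝ)) = Fintype.card α := by
    rw [← Nat.cast_sum, P.sum_card_parts, card_univ]
  simp only [sum_const, card_univ, nsmul_eq_mul, ← mul_sum, h2]
  ring

open Classical in
/-- A single homomorphism into the reduced graph, all of whose vertices lie in large pieces of their
parts, forces a positive proportion of all `p` to be homomorphisms into the graph itself. -/
theorem card_partite_homs_ge {n : ℕ} {X : Type*} [Fintype X] (Γ : SimpleGraph (Fin n × X))
    (H : SimpleGraph (Fin n)) (P : Finpartition (univ : Finset (Fin n × X))) {ε d r κ : ℝ}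
    (hε : 0 ≤ ε) (hd0 : 0 < d) (hd1 : d ≤ 1) (hr : 0 < r) (hκ0 : 0 ≤ κ) (hκ1 : κ ≤ 1)
    (hκ : ∀ s ∈ P.parts, κ * Fintype.card X ≤ r * #s)
    (hεd : (n : ℝ) ^ 2 * (ε / r ^ 2) ≤ d ^ n ^ 2 / 2) (p : Fin n → X)
    (hp : ∀ u v, H.Adj u v → (Γ.regularityReduced P ε d).Adj (u, p u) (v, p v))
    (hlarge : ∀ u v, H.Adj u v →
      r * #(P.part (u, p u)) ≤ #{b ∈ P.part (u, p u) | b.1 = u}) :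
    d ^ n ^ 2 / 2 * (κ * Fintype.card X) ^ n ≤
      #{q : Fin n → X | ∀ u v, H.Adj u v → Γ.Adj (u, q u) (v, q v)} := by
  -- isolated vertices are unconstrained: the part containing them may be unfavourable
  let U : Fin n → Finset X := fun w =>
    if ∃ v, H.Adj w v then ({x | (w, x) ∈ P.part (w, p w)} : Finset X) else univ
  have hUmem : ∀ u v x, H.Adj u v → x ∈ U u → (u, x) ∈ P.part (u, p u) := by
    intro u v x huv hx
    simp only [U] at hx
    rw [if_pos ⟨v, huv⟩] at hx
    simpa using hx
  have hUcard : ∀ u v, H.Adj u v → r * #(P.part (u, p u)) ≤ #(U u) := by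
    intro u v huv
    refine (hlarge u v huv).trans ?_
    have : ({b ∈ P.part (u, p u) | b.1 = u} : Finset _) ⊆ (U u).image fun x => (u, x) := by
      rintro ⟨w, x⟩ hb
      simp only [mem_filter] at hb
      obtain ⟨hb, rfl⟩ := hb
      refine mem_image.2 ⟨x, ?_, rfl⟩
      simp only [U]
      rw [if_pos ⟨v, huv⟩]
      simpa using hb
    exact_mod_cast (card_le_card this).trans card_image_le
  have hUκ : ∀ u, κ * Fintype.card X ≤ #(U u) := by
    intro u
    by_cases h : ∃ v, H.Adj u v
    · obtain ⟨v, huv⟩ := h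
      exact (hκ _ (P.part_mem.2 (mem_univ _))).trans (hUcard u v huv)
    · have : #(U u) = Fintype.card X := by simp only [U]; rw [if_neg h, card_univ]
      rw [this]
      have : (0 : ℝ) ≤ Fintype.card X := by positivity
      nlinarith
  let F : Finset (Fin n × Fin n) := {e | e.1 < e.2 ∧ H.Adj e.1 e.2}
  let R : ∀ u v : Fin n, U u → U v → Prop := fun u v x y => Γ.Adj (u, x.1) (v, y.1)
  have hcount := card_filter_forall_rel_ge (Y := fun w => U w) R hd0.le hd1
    (by positivity : 0 ≤ ε / r ^ 2) F (fun e he => (mem_filter.1 he).2.1) ?_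
  · have hF : #F ≤ n ^ 2 := by
      refine (card_le_univ _).trans (le_of_eq ?_)
      simp [sq]
    have h1 : d ^ n ^ 2 ≤ d ^ #F := pow_le_pow_of_le_one hd0.le hd1 hF
    have h2 : (#F : ℝ) * (ε / r ^ 2) ≤ (n : ℝ) ^ 2 * (ε / r ^ 2) := by
      gcongr
      exact_mod_cast hF
    have h3 : (κ * Fintype.card X) ^ n ≤ ∏ w, (Fintype.card (U w) : ℝ) := by
      have : ∏ _w : Fin n, (κ * Fintype.card X) ≤ ∏ w, (Fintype.card (U w) : ℝ) := by
        refine prod_le_prod (fun _ _ => by positivity) fun w _ => ?_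
        rw [Fintype.card_coe]
        exact hUκ w
      simpa using this
    have h4 : d ^ n ^ 2 / 2 * (κ * Fintype.card X) ^ n ≤
        (d ^ #F - #F * (ε / r ^ 2)) * ∏ w, (Fintype.card (U w) : ℝ) := by
      refine mul_le_mul ?_ h3 (by positivity) ?_
      · linarith
      · have : 0 < d ^ n ^ 2 := by positivity
        linarith
    refine (h4.trans hcount).trans ?_
    refine Nat.cast_le.2 (card_le_card_of_injOn (fun q w => (q w).1) ?_ ?_)
    · intro q hq
      simp only [coe_filter, mem_univ, true_and, Set.mem_ofPred_eq] at hq ⊢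
      intro u v huv
      rcases lt_trichotomy u v with h | h | h
      · exact hq (u, v) (mem_filter.2 ⟨mem_univ _, h, huv⟩)
      · exact absurd huv (h ▸ H.irrefl)
      · exact (hq (v, u) (mem_filter.2 ⟨mem_univ _, h, huv.symm⟩)).symm
    · intro q _ q' _ h
      ext w
      exact congrFun h w
  · rintro ⟨u, v⟩ he S T
    obtain ⟨-, hlt, huv⟩ := mem_filter.1 he
    simp only at hlt huv S T ⊢
    obtain ⟨-, s, hs, t, ht, hus, hvt, -, hunif, hdens⟩ := hp u v huv
    have hs' : P.part (u, p u) = s := P.part_eq_of_mem hs hus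
    have ht' : P.part (v, p v) = t := P.part_eq_of_mem ht hvt
    have hUu := hUcard u v huv
    have hUv := hUcard v u huv.symm
    rw [hs'] at hUu
    rw [ht'] at hUv
    let ι : ∀ w : Fin n, U w ↪ Fin n × X := fun w => ⟨fun x => (w, x.1), by
      intro x y h
      exact Subtype.ext (congrArg Prod.snd h)⟩
    have hS : S.map (ι u) ⊆ s := by
      intro z hz
      obtain ⟨x, -, rfl⟩ := mem_map.1 hz
      exact hs' ▸ hUmem u v x.1 huv x.2
    have hT : T.map (ι v) ⊆ t := by
      intro z hz
      obtain ⟨x, -, rfl⟩ := mem_map.1 hz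
      exact ht' ▸ hUmem v u x.1 huv.symm x.2
    have hmain := hunif.le_card_interedges hdens hS hT
    rw [card_map, card_map] at hmain
    have hinter : #(Γ.interedges (S.map (ι u)) (T.map (ι v))) ≤
        #{z ∈ S ×ˢ T | R u v z.1 z.2} := by
      have : Γ.interedges (S.map (ι u)) (T.map (ι v)) ⊆
          ({z ∈ S ×ˢ T | R u v z.1 z.2} : Finset _).image fun z => (ι u z.1, ι v z.2) := by
        rintro ⟨a, b⟩ hab
        obtain ⟨ha, hb, hadj⟩ := (SimpleGraph.mk_mem_interedges_iff _).1 hab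
        obtain ⟨x, hx, rfl⟩ := mem_map.1 ha
        obtain ⟨y, hy, rfl⟩ := mem_map.1 hb
        exact mem_image.2 ⟨(x, y), mem_filter.2 ⟨mem_product.2 ⟨hx, hy⟩, hadj⟩, rfl⟩
      exact (card_le_card this).trans card_image_le
    have herr : ε * (#s * #t) ≤ ε / r ^ 2 * (Fintype.card (U u) * Fintype.card (U v)) := by
      rw [Fintype.card_coe, Fintype.card_coe]
      calc ε * (#s * #t : ℝ) = ε / r ^ 2 * ((r * #s) * (r * #t)) := by field_simp
        _ ≤ _ := by gcongr
    have hinter' : (#(Γ.interedges (S.map (ι u)) (T.map (ι v))) : ℝ) ≤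
        #{z ∈ S ×ˢ T | R u v z.1 z.2} := by exact_mod_cast hinter
    linarith

/-- Every part of an equipartition into at most `M` parts has at least average size, up to a factor
two. -/
theorem Finpartition.IsEquipartition.card_div_le_card {α : Type*} [Fintype α] [DecidableEq α]
    {P : Finpartition (univ : Finset α)} (hP : P.IsEquipartition) {M : ℕ} (hM : #P.parts ≤ M)
    {s : Finset α} (hs : s ∈ P.parts) :
    (Fintype.card α : ℝ) / (2 * M) ≤ #s := by
  have hpos : 0 < #P.parts := card_pos.2 ⟨s, hs⟩
  have h1 := hP.average_le_card_part hs
  have h2 : #P.parts ≤ Fintype.card α := P.card_parts_le_card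
  rw [card_univ] at h1
  have h3 : Fintype.card α ≤ 2 * #P.parts * (Fintype.card α / #P.parts) := by
    have h4 := Nat.div_add_mod (Fintype.card α) #P.parts
    have h5 := Nat.mod_lt (Fintype.card α) hpos
    have h6 : 1 ≤ Fintype.card α / #P.parts := (Nat.one_le_div_iff hpos).2 h2
    nlinarith
  have h4 : Fintype.card α ≤ #s * (2 * M) := by
    calc _ ≤ 2 * #P.parts * (Fintype.card α / #P.parts) := h3
      _ ≤ 2 * M * #s := by gcongr
      _ = _ := by ring
  have hM0 : (0 : ℝ) < M := by exact_mod_cast hpos.trans_le hM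
  rw [div_le_iff₀ (by positivity)]
  exact_mod_cast h4

theorem ncard_setOf_eq_card_filter {α : Type*} [Fintype α] (p : α → Prop) [DecidablePred p] :
    {a | p a}.ncard = #{a | p a} := by
  rw [← Set.ncard_coe_finset, coe_filter_univ]

/-- **Partite graph removal lemma.** Fix a graph `H` on `Fin n`, and a graph `Γ` on `n` copies
of `X`. If few maps `p : Fin n → X` send every edge `u v` of `H` to an edge
`(u, p u) (v, p v)` of `Γ`, then deleting few edges of `Γ` destroys all such maps; the meaning of
few does not depend on `X`, `Γ` or `H`. -/
theorem exists_partite_graph_removal {n : ℕ} (hn : 0 < n) {ε : ℝ} (hε : 0 < ε) :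
    ∃ δ : ℝ, 0 < δ ∧ ∀ (X : Type*) [Finite X] (Γ : SimpleGraph (Fin n × X))
      (H : SimpleGraph (Fin n)),
      ({p : Fin n → X | ∀ u v, H.Adj u v → Γ.Adj (u, p u) (v, p v)}.ncard : ℝ) <
        δ * (Nat.card X : ℝ) ^ n →
      ∃ Γ' ≤ Γ,
        ({z : (Fin n × X) × (Fin n × X) | Γ.Adj z.1 z.2 ∧ ¬ Γ'.Adj z.1 z.2}.ncard : ℝ) ≤
          ε * (Nat.card X : ℝ) ^ 2 ∧
        ∀ p : Fin n → X, ∃ u v, H.Adj u v ∧ ¬ Γ'.Adj (u, p u) (v, p v) := by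
  classical
  have hn' : (0 : ℝ) < n := by exact_mod_cast hn
  -- each of the four kinds of deleted edges gets a quarter of the budget `e * (n * card X) ^ 2`
  obtain ⟨e, he0, he1, heε⟩ : ∃ e : ℝ, 0 < e ∧ e ≤ 1 ∧ e * n ^ 2 ≤ ε := by
    refine ⟨min 1 (ε / n ^ 2), by positivity, min_le_left _ _, ?_⟩
    calc min 1 (ε / n ^ 2) * (n : ℝ) ^ 2 ≤ ε / n ^ 2 * n ^ 2 := by gcongr; exact min_le_right _ _
      _ = ε := by field_simp
  obtain ⟨d, hd⟩ : ∃ d, d = e / 16 := ⟨_, rfl⟩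
  have hd0 : 0 < d := by rw [hd]; positivity
  obtain ⟨r, hr⟩ : ∃ r, r = e / (8 * n) := ⟨_, rfl⟩
  have hr0 : 0 < r := by rw [hr]; positivity
  have hr1 : r ≤ 1 := by
    rw [hr, div_le_one (by positivity)]
    have : (1 : ℝ) ≤ n := by exact_mod_cast hn
    linarith
  obtain ⟨γ, hγ0, hγe, hγd⟩ : ∃ γ : ℝ, 0 < γ ∧ γ ≤ e / 16 ∧
      (n : ℝ) ^ 2 * (γ / r ^ 2) ≤ d ^ n ^ 2 / 2 := by
    refine ⟨min (e / 16) (r ^ 2 * d ^ n ^ 2 / (2 * n ^ 2)), by positivity, min_le_left _ _, ?_⟩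
    calc _ ≤ (n : ℝ) ^ 2 * (r ^ 2 * d ^ n ^ 2 / (2 * n ^ 2) / r ^ 2) := by
          gcongr; exact min_le_right _ _
      _ = _ := by field_simp
  obtain ⟨l, hl⟩ : ∃ l : ℕ, 8 / e ≤ l := exists_nat_ge _
  have hl0 : (0 : ℝ) < l := lt_of_lt_of_le (by positivity) hl
  obtain ⟨M, hMl⟩ : ∃ M : ℕ, M = SzemerediRegularity.bound γ l := ⟨_, rfl⟩
  have hM : 1 ≤ (M : ℝ) := by
    rw [hMl]
    exact_mod_cast SzemerediRegularity.bound_pos (ε := γ) (l := l)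
  obtain ⟨κ, hκ⟩ : ∃ κ : ℝ, κ = r / (2 * M) := ⟨_, rfl⟩
  have hκ0 : 0 < κ := by rw [hκ]; positivity
  have hκ1 : κ ≤ 1 := by
    rw [hκ, div_le_one (by positivity)]
    linarith
  refine ⟨min (d ^ n ^ 2 / 2 * κ ^ n) ((1 / l) ^ n), by positivity, ?_⟩
  intro X _ Γ H hfew
  have := Fintype.ofFinite X
  rw [ncard_setOf_eq_card_filter] at hfew
  rw [Nat.card_eq_fintype_card] at hfew ⊢
  have hX : 0 < Fintype.card X := by
    rw [Nat.pos_iff_ne_zero]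
    intro h
    rw [h, Nat.cast_zero, zero_pow hn.ne', mul_zero] at hfew
    exact absurd hfew (not_lt.2 (by positivity))
  have hXle : Fintype.card X ≤ Fintype.card (Fin n × X) := by
    rw [Fintype.card_prod, Fintype.card_fin]
    exact Nat.le_mul_of_pos_left _ hn
  by_cases hsmall : Fintype.card (Fin n × X) < l
  · -- there are fewer than one, hence no, homomorphisms
    refine ⟨Γ, le_rfl, ?_, ?_⟩
    · simp only [and_not_self, Set.ofPred_false, Set.ncard_empty, Nat.cast_zero]
      positivity
    · by_contra! h
      obtain ⟨p, hp⟩ := h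
      have h1 : (1 : ℝ) ≤ #{p : Fin n → X | ∀ u v, H.Adj u v → Γ.Adj (u, p u) (v, p v)} := by
        have : 0 < #{p : Fin n → X | ∀ u v, H.Adj u v → Γ.Adj (u, p u) (v, p v)} :=
          card_pos.2 ⟨p, by simpa using hp⟩
        exact_mod_cast this
      have h2 : (1 / l : ℝ) ^ n * (Fintype.card X : ℝ) ^ n ≤ 1 := by
        rw [← mul_pow]
        refine pow_le_one₀ (by positivity) ?_
        rw [one_div, inv_mul_le_iff₀ hl0, mul_one]
        exact_mod_cast hXle.trans hsmall.le
      have h3 := mul_le_mul_of_nonneg_right (min_le_right (d ^ n ^ 2 / 2 * κ ^ n) ((1 / l : ℝ) ^ n))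
        (by positivity : 0 ≤ (Fintype.card X : ℝ) ^ n)
      linarith
  · have : Nonempty (Fin n × X) := Fintype.card_pos_iff.1 (hX.trans_le hXle)
    obtain ⟨P, hP, hPl, hPM, hPu⟩ := szemeredi_regularity Γ hγ0 (not_lt.1 hsmall)
    rw [← hMl] at hPM
    let D : Finset (Fin n × X) :=
      {a | (#{b ∈ P.part a | b.1 = a.1} : ℝ) < r * #(P.part a)}
    have hD : (#D : ℝ) ≤ r * n * Fintype.card (Fin n × X) := by
      simpa using card_small_fibers_le P (fun b => b.1) hr0.le
    let Γ₁ := Γ.regularityReduced P γ d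
    let Γ' : SimpleGraph (Fin n × X) :=
      { Adj := fun a b => Γ₁.Adj a b ∧ a ∉ D ∧ b ∉ D
        symm := ⟨fun a b h => ⟨h.1.symm, h.2.2, h.2.1⟩⟩
        loopless := ⟨fun a h => Γ₁.irrefl h.1⟩ }
    refine ⟨Γ', fun a b h => h.1.1, ?_, ?_⟩
    · have hred := card_filter_adj_not_regularityReduced_le Γ hP hγ0 hd0.le
        (by positivity : 0 < e / 2) hPu (by
          have h1 : 4 / (e / 2) = 8 / e := by field_simp; norm_num
          rw [h1]
          exact hl.trans (by exact_mod_cast hPl))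
      have hsub : ({z : (Fin n × X) × (Fin n × X) | Γ.Adj z.1 z.2 ∧ ¬ Γ'.Adj z.1 z.2} : Finset _) ⊆
          (({z | Γ.Adj z.1 z.2 ∧ ¬ Γ₁.Adj z.1 z.2} : Finset ((Fin n × X) × (Fin n × X))) ∪
            D ×ˢ univ) ∪ univ ×ˢ D := by
        rintro ⟨a, b⟩ hz
        simp only [mem_filter, mem_univ, true_and, Γ', not_and_or, not_not] at hz
        simp only [mem_union, mem_filter, mem_univ, true_and, mem_product, and_true]
        tauto
      have h1 := (card_le_card hsub).trans (card_union_le _ _)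
      have h2 := card_union_le
        ({z | Γ.Adj z.1 z.2 ∧ ¬ Γ₁.Adj z.1 z.2} : Finset ((Fin n × X) × (Fin n × X))) (D ×ˢ univ)
      rw [card_product, card_univ] at h1 h2
      have h3 : (#{z : (Fin n × X) × (Fin n × X) | Γ.Adj z.1 z.2 ∧ ¬ Γ'.Adj z.1 z.2} : ℝ) ≤
          #{z : (Fin n × X) × (Fin n × X) | Γ.Adj z.1 z.2 ∧ ¬ Γ₁.Adj z.1 z.2} +
            #D * Fintype.card (Fin n × X) + Fintype.card (Fin n × X) * #D := by
        exact_mod_cast h1.trans (by omega)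
      have hN : (Fintype.card (Fin n × X) : ℝ) = n * Fintype.card X := by simp
      have hrn : r * n = e / 8 := by rw [hr]; field_simp
      rw [hrn] at hD
      set N : ℝ := (Fintype.card (Fin n × X) : ℝ) with hNdef
      have hN0 : 0 ≤ N := by positivity
      have h4 : (#D : ℝ) * N ≤ e / 8 * N * N := by gcongr
      have h5 : (4 * γ + e / 2 / 2 + 4 * d) * N ^ 2 ≤ 3 / 4 * e * N ^ 2 := by
        gcongr
        linarith
      have h6 : 3 / 4 * e * N ^ 2 + #D * N + N * #D ≤ e * N ^ 2 := by nlinarith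
      have h7 := calc
        _ ≤ _ := h3
        _ ≤ 3 / 4 * e * N ^ 2 + #D * N + N * #D := by
          gcongr
          convert hred.trans h5
        _ ≤ e * N ^ 2 := h6
        _ = e * n ^ 2 * (Fintype.card X : ℝ) ^ 2 := by rw [hN]; ring
        _ ≤ ε * (Fintype.card X : ℝ) ^ 2 := by gcongr
      rw [ncard_setOf_eq_card_filter]
      exact h7
    · by_contra! h
      obtain ⟨p, hp⟩ := h
      have hcount := card_partite_homs_ge Γ H P hγ0.le hd0 (by linarith) hr0 hκ0.le hκ1
        (fun s hs => ?_) hγd p (fun u v huv => (hp u v huv).1) (fun u v huv => ?_)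
      · rw [mul_pow, ← mul_assoc] at hcount
        have h3 := mul_le_mul_of_nonneg_right
          (min_le_left (d ^ n ^ 2 / 2 * κ ^ n) ((1 / l : ℝ) ^ n))
          (by positivity : 0 ≤ (Fintype.card X : ℝ) ^ n)
        linarith
      · have h1 := hP.card_div_le_card hPM hs
        calc κ * Fintype.card X ≤ κ * Fintype.card (Fin n × X) := by gcongr
          _ = r * (Fintype.card (Fin n × X) / (2 * M)) := by rw [hκ]; ring
          _ ≤ r * #s := by gcongr
      · have h1 := (hp u v huv).2.1
        simpa [D] using h1

/-! ### Potentials and the cycle space -/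

namespace ArcDigraph

variable {V : Type} {m : ℕ} {H : ArcDigraph V m} {G : Type*} [AddCommGroup G]

theorem Cycle.sum_charVec_smul (C : H.Cycle) (x : Fin m → G) :
    ∑ j, C.charVec j • x j =
      ∑ t, if C.fwd t = true then x (C.arc t) else - x (C.arc t) := by
  simp only [Cycle.charVec, sum_smul]
  rw [sum_comm]
  refine sum_congr rfl fun t _ => ?_
  rw [sum_eq_single (C.arc t)]
  · rw [if_pos rfl]
    split_ifs <;> simp
  · intro j _ hj
    rw [if_neg (Ne.symm hj), zero_smul]
  · simp

/-- The differences of a potential along a cycle telescope. -/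
theorem Cycle.sum_charVec_smul_potential (C : H.Cycle) (p : V → G) :
    ∑ j, C.charVec j • (p (H.tgt j) - p (H.src j)) = 0 := by
  rw [C.sum_charVec_smul (fun j => p (H.tgt j) - p (H.src j))]
  have h : ∀ t, (if C.fwd t = true then p (H.tgt (C.arc t)) - p (H.src (C.arc t))
      else -(p (H.tgt (C.arc t)) - p (H.src (C.arc t)))) =
      p (C.vert (t + 1)) - p (C.vert t) := by
    intro t
    split_ifs with hf
    · rw [(C.step_fwd t hf).1, (C.step_fwd t hf).2]
    · have hf' : C.fwd t = false := by simpa using hf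
      rw [(C.step_bwd t hf').1, (C.step_bwd t hf').2, neg_sub]
  simp only [h]
  rw [sum_sub_distrib, sub_eq_zero]
  exact Equiv.sum_comp (Equiv.addRight (1 : Fin (C.len + 1))) fun t => p (C.vert t)

/-- The simple graph in which two vertices are adjacent if some arc in `S` joins them. -/
def arcGraph (H : ArcDigraph V m) (S : Finset (Fin m)) : SimpleGraph V :=
  SimpleGraph.fromRel fun a b => ∃ j ∈ S, H.src j = a ∧ H.tgt j = b

theorem arcGraph_adj {S : Finset (Fin m)} {a b : V} : (H.arcGraph S).Adj a b ↔ a ≠ b ∧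
    ((∃ j ∈ S, H.src j = a ∧ H.tgt j = b) ∨ ∃ j ∈ S, H.src j = b ∧ H.tgt j = a) :=
  SimpleGraph.fromRel_adj _ _ _

/-- If the ends of an arc `j` are joined by a path of arcs in `S`, then that path and `j` form a
cycle; so if `x` sums to zero along all cycles and is a potential difference on `S`, it is also one
on `j`. -/
theorem potential_sub_eq_of_reachable (x : Fin m → G)
    (hx : ∀ C : H.Cycle, ∑ j, C.charVec j • x j = 0) (S : Finset (Fin m)) (p : V → G)
    (hp : ∀ j ∈ S, x j = p (H.tgt j) - p (H.src j)) (j : Fin m) (hj : j ∉ S)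
    (hreach : (H.arcGraph S).Reachable (H.tgt j) (H.src j)) :
    x j = p (H.tgt j) - p (H.src j) := by
  classical
  obtain ⟨w, hw⟩ := hreach.exists_isPath
  have harc : ∀ t, t < w.length → ∃ i ∈ S, ∃ b : Bool,
      (b = true → H.src i = w.getVert t ∧ H.tgt i = w.getVert (t + 1)) ∧
      (b = false → H.tgt i = w.getVert t ∧ H.src i = w.getVert (t + 1)) := by
    intro t ht
    have hadj := w.adj_getVert_succ ht
    rw [arcGraph_adj] at hadj
    obtain ⟨-, ⟨i, hi, h1, h2⟩ | ⟨i, hi, h1, h2⟩⟩ := hadj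
    · exact ⟨i, hi, true, by simp [h1, h2], by simp⟩
    · exact ⟨i, hi, false, by simp, by simp [h1, h2]⟩
  have : Nonempty (Fin m) := ⟨j⟩
  choose! a haS b hbt hbf using harc
  have hinj : ∀ s t, s ≤ w.length → t ≤ w.length → w.getVert s = w.getVert t → s = t :=
    fun s t hs ht h => hw.getVert_injOn hs ht h
  let C : H.Cycle :=
    { len := w.length
      vert := fun t => w.getVert t
      arc := fun t => if (t : ℕ) < w.length then a t else j
      fwd := fun t => if (t : ℕ) < w.length then b t else true
      vert_injective := fun s t h => Fin.ext (hinj _ _ (by omega) (by omega) h)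
      arc_injective := by
        intro s t h
        simp only at h
        split_ifs at h with hs ht ht
        · -- an arc determines its set of ends, and the vertices of a path are distinct
          have h1 := hbt s hs
          have h2 := hbf s hs
          have h3 := hbt t ht
          have h4 := hbf t ht
          rw [h] at h1 h2
          apply Fin.ext
          cases hbs : b s <;> cases hbt' : b t
          · exact hinj _ _ hs.le ht.le ((h2 hbs).1.symm.trans (h4 hbt').1)
          · have e1 := hinj _ _ hs.le (Nat.succ_le_of_lt ht)
              ((h2 hbs).1.symm.trans (h3 hbt').2)
            have e2 := hinj _ _ (Nat.succ_le_of_lt hs) ht.le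
              ((h2 hbs).2.symm.trans (h3 hbt').1)
            omega
          · have e1 := hinj _ _ hs.le (Nat.succ_le_of_lt ht)
              ((h1 hbs).1.symm.trans (h4 hbt').2)
            have e2 := hinj _ _ (Nat.succ_le_of_lt hs) ht.le
              ((h1 hbs).2.symm.trans (h4 hbt').1)
            omega
          · exact hinj _ _ hs.le ht.le ((h1 hbs).1.symm.trans (h3 hbt').1)
        · exact absurd (h ▸ haS s hs) hj
        · exact absurd (h ▸ haS t ht) hj
        · exact Fin.ext (by omega)
      step_fwd := by
        intro t ht
        by_cases h : (t : ℕ) < w.length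
        · simp only [if_pos h] at ht ⊢
          rw [Fin.val_add_one_of_lt (Fin.lt_def.2 (by simpa using h))]
          exact hbt t h ht
        · simp only [if_neg h]
          have ht' : t = Fin.last w.length := Fin.ext (by simp; omega)
          subst ht'
          simp
      step_bwd := by
        intro t ht
        by_cases h : (t : ℕ) < w.length
        · simp only [if_pos h] at ht ⊢
          rw [Fin.val_add_one_of_lt (Fin.lt_def.2 (by simpa using h))]
          exact hbf t h ht
        · simp [h] at ht }
  -- subtract from `x` the difference of `p`: what remains vanishes on `S`
  have h0 : ∑ i, C.charVec i • (x i - (p (H.tgt i) - p (H.src i))) = 0 := by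
    simp only [smul_sub (_ : ℤ) (x _), sum_sub_distrib]
    rw [hx C, C.sum_charVec_smul_potential p, sub_zero]
  rw [C.sum_charVec_smul (fun i => x i - (p (H.tgt i) - p (H.src i))), Fin.sum_univ_castSucc,
    sum_eq_zero, zero_add] at h0
  · simpa [C, sub_eq_zero] using h0
  · intro t _
    have ht : C.arc t.castSucc ∈ S := by simpa [C] using haS t t.2
    rw [hp _ ht, sub_self, neg_zero, ite_self]

/-- A vector that sums to zero along every cycle is the difference of a potential. -/
theorem exists_potential (x : Fin m → G) (hx : ∀ C : H.Cycle, ∑ j, C.charVec j • x j = 0) :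
    ∃ p : V → G, ∀ j, x j = p (H.tgt j) - p (H.src j) := by
  classical
  suffices h : ∀ S : Finset (Fin m), ∃ p : V → G, ∀ j ∈ S, x j = p (H.tgt j) - p (H.src j) by
    obtain ⟨p, hp⟩ := h univ
    exact ⟨p, fun j => hp j (mem_univ j)⟩
  intro S
  induction S using Finset.induction_on with
  | empty => exact ⟨0, by simp⟩
  | insert j S hj ih =>
    obtain ⟨p, hp⟩ := ih
    by_cases hreach : (H.arcGraph S).Reachable (H.tgt j) (H.src j)
    · refine ⟨p, fun i hi => ?_⟩
      rcases mem_insert.1 hi with rfl | hi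
      · exact potential_sub_eq_of_reachable x hx S p hp i hj hreach
      · exact hp i hi
    · -- shift the potential on the component of the end of the new arc
      let g : G := x j - (p (H.tgt j) - p (H.src j))
      refine ⟨fun v => if (H.arcGraph S).Reachable (H.tgt j) v then p v + g else p v,
        fun i hi => ?_⟩
      rcases mem_insert.1 hi with rfl | hi
      · simp only [if_neg hreach, if_pos (SimpleGraph.Reachable.refl _), g]
        abel
      · have hadj : (H.arcGraph S).Reachable (H.src i) (H.tgt i) := by
          by_cases he : H.src i = H.tgt i
          · rw [he]
          · refine SimpleGraph.Adj.reachable ?_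
            rw [arcGraph_adj]
            exact ⟨he, Or.inl ⟨i, hi, rfl, rfl⟩⟩
        have hiff : (H.arcGraph S).Reachable (H.tgt j) (H.tgt i) ↔
            (H.arcGraph S).Reachable (H.tgt j) (H.src i) :=
          ⟨fun h => h.trans hadj.symm, fun h => h.trans hadj⟩
        rw [hp i hi]
        by_cases h : (H.arcGraph S).Reachable (H.tgt j) (H.src i)
        · simp only [if_pos h, if_pos (hiff.2 h)]
          abel
        · simp only [if_neg h, if_neg (mt hiff.1 h)]

/-- If the vectors `c i` integrally generate the cycle space, the solutions of the system are
exactly the differences of potentials. -/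
theorem IntegrallyGenerates.forall_sum_smul_eq_zero_iff {k : ℕ} {c : Fin k → Fin m → ℤ}
    (h : IntegrallyGenerates c H) (x : Fin m → G) :
    (∀ i, ∑ j, c i j • x j = 0) ↔ ∃ p : V → G, ∀ j, x j = p (H.tgt j) - p (H.src j) := by
  classical
  constructor
  · intro hx
    apply exists_potential
    intro C
    have hC := h.charVec_mem_span C
    generalize C.charVec = v at hC
    induction hC using Submodule.span_induction with
    | mem v hv =>
      obtain ⟨i, rfl⟩ := hv
      exact hx i
    | zero => simp
    | add v w _ _ hv hw => simp [add_smul, sum_add_distrib, hv, hw]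
    | smul a v _ hv => simp [mul_smul, ← smul_sum, hv]
  · rintro ⟨p, hp⟩ i
    -- `c i` is orthogonal over `ℚ`, hence over `ℤ`, to the coboundary of each function on `V`
    have horth : ∀ q : V → ℤ, ∑ j, c i j * (q (H.tgt j) - q (H.src j)) = 0 := by
      intro q
      have hmem := h.mem_cycleSpace i
      have hQ : ∑ j, ratVec (c i) j * ((q (H.tgt j) : ℚ) - q (H.src j)) = 0 := by
        generalize ratVec (c i) = v at hmem
        rw [cycleSpace] at hmem
        induction hmem using Submodule.span_induction with
        | mem v hv =>
          obtain ⟨C, rfl⟩ := hv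
          have := C.sum_charVec_smul_potential (fun v => (q v : ℚ))
          simpa [ratVec, zsmul_eq_mul] using this
        | zero => simp
        | add v w _ _ hv hw => simp [add_mul, sum_add_distrib, hv, hw]
        | smul a v _ hv => simp [mul_assoc, ← mul_sum, hv]
      have : ((∑ j, c i j * (q (H.tgt j) - q (H.src j)) : ℤ) : ℚ) = 0 := by
        rw [← hQ]
        push_cast
        rfl
      exact_mod_cast this
    let I : Finset V := univ.image H.src ∪ univ.image H.tgt
    have hsrc : ∀ j, H.src j ∈ I := fun j => mem_union_left _ (mem_image_of_mem _ (mem_univ j))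
    have htgt : ∀ j, H.tgt j ∈ I := fun j => mem_union_right _ (mem_image_of_mem _ (mem_univ j))
    -- expand `p` over the indicators of vertices
    have hexp : ∀ v ∈ I, p v = ∑ u ∈ I, (if v = u then (1 : ℤ) else 0) • p u := by
      intro v hv
      simp [ite_smul, hv]
    calc ∑ j, c i j • x j
        = ∑ j, ∑ u ∈ I, (c i j * ((if H.tgt j = u then (1 : ℤ) else 0) -
            (if H.src j = u then 1 else 0))) • p u := by
          refine sum_congr rfl fun j _ => ?_
          rw [hp j, hexp _ (htgt j), hexp _ (hsrc j), ← sum_sub_distrib, smul_sum]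
          refine sum_congr rfl fun u _ => ?_
          rw [← sub_smul, mul_smul]
      _ = ∑ u ∈ I, (∑ j, c i j * ((if H.tgt j = u then (1 : ℤ) else 0) -
            (if H.src j = u then 1 else 0))) • p u := by
          rw [sum_comm]
          exact sum_congr rfl fun u _ => (sum_smul ..).symm
      _ = 0 := by
          refine sum_eq_zero fun u _ => ?_
          rw [horth (fun v => if v = u then 1 else 0), zero_smul]

end ArcDigraph

/-! ### Counting potentials -/

namespace ArcDigraph

variable {V : Type} {m : ℕ} {H : ArcDigraph V m} {G : Type*} [AddCommGroup G]

/-- Only the ends of arcs matter for potentials: renaming them injectively changes nothing. -/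
theorem exists_potential_comp_iff {W : Type} {f : V → W}
    (hf : Set.InjOn f (Set.range H.src ∪ Set.range H.tgt)) (x : Fin m → G) :
    (∃ p : V → G, ∀ j, x j = p (H.tgt j) - p (H.src j)) ↔
      ∃ q : W → G, ∀ j, x j = q (f (H.tgt j)) - q (f (H.src j)) := by
  constructor
  · rintro ⟨p, hp⟩
    let I := Set.range H.src ∪ Set.range H.tgt
    have hinj : Function.Injective (fun v : I => f v) := fun v w h =>
      Subtype.ext (hf v.2 w.2 h)
    refine ⟨Function.extend (fun v : I => f v) (fun v => p v) 0, fun j => ?_⟩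
    have h1 := hinj.extend_apply (fun v => p v) 0 ⟨H.tgt j, Or.inr ⟨j, rfl⟩⟩
    have h2 := hinj.extend_apply (fun v => p v) 0 ⟨H.src j, Or.inl ⟨j, rfl⟩⟩
    simp only at h1 h2
    rw [h1, h2, hp j]
  · rintro ⟨q, hq⟩
    exact ⟨q ∘ f, hq⟩

/-- The at most `2 * m` ends of the arcs can be named by `Fin (2 * m)`. -/
theorem exists_injOn_fin (H : ArcDigraph V m) (hm : 0 < m) :
    ∃ f : V → Fin (2 * m), Set.InjOn f (Set.range H.src ∪ Set.range H.tgt) := by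
  classical
  let I : Finset V := univ.image H.src ∪ univ.image H.tgt
  have hI : Fintype.card I ≤ Fintype.card (Fin (2 * m)) := by
    rw [Fintype.card_coe, Fintype.card_fin]
    refine (card_union_le _ _).trans ?_
    have h1 := card_image_le (s := univ) (f := H.src)
    have h2 := card_image_le (s := univ) (f := H.tgt)
    rw [card_univ, Fintype.card_fin] at h1 h2
    omega
  obtain ⟨g⟩ := Function.Embedding.nonempty_of_card_le hI
  refine ⟨fun v => if h : v ∈ I then g ⟨v, h⟩ else ⟨0, by omega⟩, fun v hv w hw h => ?_⟩
  have hmem : ∀ v ∈ Set.range H.src ∪ Set.range H.tgt, v ∈ I := by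
    rintro _ (⟨j, rfl⟩ | ⟨j, rfl⟩) <;> simp [I]
  simp only [dif_pos (hmem v hv), dif_pos (hmem w hw)] at h
  exact congrArg Subtype.val (g.injective h)

/-- Functions that agree at the two ends of every arc are constant on components. -/
theorem apply_eq_of_reachable {α : Type*} {q : V → α} (hq : ∀ j, q (H.tgt j) = q (H.src j))
    {v w : V} (h : (H.arcGraph univ).Reachable v w) : q v = q w := by
  obtain ⟨p⟩ := h
  induction p with
  | nil => rfl
  | cons hadj _ ih =>
    refine Eq.trans ?_ ih
    obtain ⟨-, ⟨j, -, rfl, rfl⟩ | ⟨j, -, rfl, rfl⟩⟩ := arcGraph_adj.1 hadj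
    exacts [(hq j).symm, hq j]

/-- Two potentials with the same differences differ by a constant on each component. -/
theorem card_potentials_le [Finite V] [Finite G] (x : Fin m → G) :
    {p : V → G | ∀ j, p (H.tgt j) - p (H.src j) = x j}.ncard ≤
      Nat.card G ^ Nat.card (H.arcGraph univ).ConnectedComponent := by
  rw [← Nat.card_fun, ← Set.ncard_univ]
  refine Set.ncard_le_ncard_of_injOn (fun p C => p C.out) (fun _ _ => Set.mem_univ _) ?_
  intro p hp q hq h
  have hconst : ∀ j, (fun v => p v - q v) (H.tgt j) = (fun v => p v - q v) (H.src j) := by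
    intro j
    have := (hp j).trans (hq j).symm
    simp only
    rw [sub_eq_sub_iff_add_eq_add] at this ⊢
    rw [add_comm (p (H.src j)), this, add_comm]
  ext v
  have h1 : (H.arcGraph univ).Reachable v ((H.arcGraph univ).connectedComponentMk v).out :=
    SimpleGraph.ConnectedComponent.exact (Quot.out_eq _).symm
  have h2 := apply_eq_of_reachable (q := fun v => p v - q v) hconst h1
  have h3 := congrFun h ((H.arcGraph univ).connectedComponentMk v)
  simp only at h2 h3
  rw [h3, sub_self, sub_eq_zero] at h2
  exact h2

/-- If all rational solutions of a system of `k` equations are potential differences, then there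
are at least `m - k` independent potential differences, so `m - k` is at most the number of vertices
minus the number of components. -/
theorem add_card_connectedComponent_le [Finite V] {k : ℕ} (c : Fin k → Fin m → ℤ)
    (h : ∀ x : Fin m → ℚ, (∀ i, ∑ j, c i j • x j = 0) →
      ∃ p : V → ℚ, ∀ j, x j = p (H.tgt j) - p (H.src j)) :
    m + Nat.card (H.arcGraph univ).ConnectedComponent ≤ k + Nat.card V := by
  have := Fintype.ofFinite V
  have := Fintype.ofFinite (H.arcGraph univ).ConnectedComponent
  let D : (V → ℚ) →ₗ[ℚ] (Fin m → ℚ) := LinearMap.funLeft ℚ ℚ H.tgt - LinearMap.funLeft ℚ ℚ H.src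
  let E : (Fin m → ℚ) →ₗ[ℚ] (Fin k → ℚ) :=
    Matrix.mulVecLin (Matrix.of fun i j => (c i j : ℚ))
  have hle : LinearMap.ker E ≤ LinearMap.range D := by
    intro x hx
    obtain ⟨p, hp⟩ := h x fun i => by
      have := congrFun (LinearMap.mem_ker.1 hx) i
      simpa [E, Matrix.mulVec, dotProduct, zsmul_eq_mul] using this
    exact ⟨p, by ext j; simp [D, hp j, LinearMap.funLeft_apply]⟩
  let J : ((H.arcGraph univ).ConnectedComponent → ℚ) →ₗ[ℚ] LinearMap.ker D :=
    LinearMap.codRestrict _ (LinearMap.funLeft ℚ ℚ (H.arcGraph univ).connectedComponentMk) (by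
      intro q
      rw [LinearMap.mem_ker]
      ext j
      have : (H.arcGraph univ).connectedComponentMk (H.tgt j) =
          (H.arcGraph univ).connectedComponentMk (H.src j) := by
        by_cases he : H.tgt j = H.src j
        · rw [he]
        · exact SimpleGraph.ConnectedComponent.sound (SimpleGraph.Adj.reachable
            (arcGraph_adj.2 ⟨he, Or.inr ⟨j, mem_univ j, rfl, rfl⟩⟩))
      simp [D, LinearMap.funLeft_apply, this])
  have hJ : Function.Injective J := by
    intro q q' hqq
    ext C
    induction C using SimpleGraph.ConnectedComponent.ind with
    | _ v => exact congrFun (congrArg Subtype.val hqq) v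
  have h1 := LinearMap.finrank_le_finrank_of_injective hJ
  have h2 := D.finrank_range_add_finrank_ker
  have h3 := E.finrank_range_add_finrank_ker
  have h4 := Submodule.finrank_mono hle
  have h5 := (LinearMap.range E).finrank_le
  rw [Nat.card_eq_fintype_card, Nat.card_eq_fintype_card]
  simp only [Module.finrank_fintype_fun_eq_card, Fintype.card_fin] at h1 h2 h3 h5
  omega

end ArcDigraph

/-! ### From edges to group elements -/

/-- Few group elements `a` have many of the pairs `(u, g), (v, g + a)` in a small set `Δ`, as these
pairs are distinct for distinct `a`. -/
theorem card_heavy_translates_mul_le {W G : Type*} [DecidableEq W] [AddCommGroup G]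
    [Fintype G] [DecidableEq G]
    (Δ : Finset ((W × G) × (W × G))) (u v : W) (m : ℕ) :
    #{a : G | Fintype.card G ≤ m * #{g : G | ((u, g), (v, g + a)) ∈ Δ}} * Fintype.card G ≤
      m * #Δ := by
  set B : Finset G := {a : G | Fintype.card G ≤ m * #{g : G | ((u, g), (v, g + a)) ∈ Δ}} with hB
  calc #B * Fintype.card G ≤ ∑ a ∈ B, m * #{g : G | ((u, g), (v, g + a)) ∈ Δ} := by
        rw [← smul_eq_mul]
        exact card_nsmul_le_sum _ _ _ fun a ha => (mem_filter.1 ha).2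
    _ = m * #(B.sigma fun a => {g : G | ((u, g), (v, g + a)) ∈ Δ}) := by
        rw [card_sigma, mul_sum]
    _ ≤ m * #Δ := by
        refine Nat.mul_le_mul_left _ (card_le_card_of_injOn
          (fun z => ((u, z.2), (v, z.2 + z.1))) ?_ ?_)
        · intro z hz
          exact (mem_filter.1 (mem_sigma.1 hz).2).2
        · rintro ⟨a, g⟩ _ ⟨a', g'⟩ _ h
          simp only [Prod.mk.injEq, true_and] at h
          obtain ⟨rfl, h⟩ := h
          rw [add_left_cancel h]

/-- Passing from group elements to edges and back: if the solutions of a system are the potential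
differences of `H`, then the partite removal property for the graph of `H` yields the removal
property for the system. -/
theorem exists_subsets_without_solutions {m k n : ℕ} {G : Type*} [AddCommGroup G] [Finite G]
    (c : Fin k → Fin m → ℤ) (H : ArcDigraph (Fin n) m)
    (hQ : ∀ x : Fin m → ℚ, (∀ i, ∑ j, c i j • x j = 0) →
      ∃ p : Fin n → ℚ, ∀ j, x j = p (H.tgt j) - p (H.src j))
    (hG : ∀ x : Fin m → G, (∀ i, ∑ j, c i j • x j = 0) ↔
      ∃ p : Fin n → G, ∀ j, x j = p (H.tgt j) - p (H.src j))
    (hm : 0 < m) {δ η : ℝ} (hδ : 0 < δ) (hη : 0 < η)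
    (hremoval : ∀ (Γ : SimpleGraph (Fin n × G)) (K : SimpleGraph (Fin n)),
      ({p : Fin n → G | ∀ u v, K.Adj u v → Γ.Adj (u, p u) (v, p v)}.ncard : ℝ) <
        δ * (Nat.card G : ℝ) ^ n →
      ∃ Γ' ≤ Γ,
        ({z : (Fin n × G) × (Fin n × G) | Γ.Adj z.1 z.2 ∧ ¬ Γ'.Adj z.1 z.2}.ncard : ℝ) ≤
          η / m * (Nat.card G : ℝ) ^ 2 ∧
        ∀ p : Fin n → G, ∃ u v, K.Adj u v ∧ ¬ Γ'.Adj (u, p u) (v, p v))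
    (A : Fin m → Set G)
    (hfew : ((systemSolutions c A).ncard : ℝ) <
      δ * (Nat.card G : ℝ) ^ ((m : ℤ) - (k : ℤ))) :
    ∃ A' : Fin m → Set G,
      (∀ j, A' j ⊆ A j) ∧
      (∀ j, ((A j \ A' j).ncard : ℝ) ≤ η * (Nat.card G : ℝ)) ∧
      systemSolutions c A' = ∅ := by
  classical
  have := Fintype.ofFinite G
  rw [Nat.card_eq_fintype_card] at hfew ⊢
  by_cases hloop : ∃ j, H.src j = H.tgt j ∧ 0 ∉ A j
  · -- a loop forces its variable to vanish
    obtain ⟨j, hj, hj0⟩ := hloop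
    refine ⟨A, fun _ => Set.Subset.rfl, fun j => ?_, ?_⟩
    · rw [Set.sdiff_self, Set.ncard_empty, Nat.cast_zero]
      positivity
    · rw [Set.eq_empty_iff_forall_notMem]
      rintro x ⟨hx, hxA⟩
      obtain ⟨p, hp⟩ := (hG x).1 hx
      apply hj0
      have := hxA j
      rwa [hp j, hj, sub_self] at this
  push Not at hloop
  have hN1 : (1 : ℝ) ≤ Fintype.card G := by exact_mod_cast Fintype.card_pos (α := G)
  have hm' : (0 : ℝ) < m := by exact_mod_cast hm
  let Γ : SimpleGraph (Fin n × G) :=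
    { Adj := fun a b => a.1 ≠ b.1 ∧ ∀ j, (H.src j = a.1 → H.tgt j = b.1 → b.2 - a.2 ∈ A j) ∧
        (H.src j = b.1 → H.tgt j = a.1 → a.2 - b.2 ∈ A j)
      symm := ⟨fun a b h => ⟨h.1.symm, fun j => ⟨(h.2 j).2, (h.2 j).1⟩⟩⟩
      loopless := ⟨fun a h => h.1 rfl⟩ }
  let K := H.arcGraph univ
  have hhom : ∀ p : Fin n → G, (∀ u v, K.Adj u v → Γ.Adj (u, p u) (v, p v)) ↔
      ∀ j, p (H.tgt j) - p (H.src j) ∈ A j := by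
    intro p
    constructor
    · intro h j
      by_cases he : H.src j = H.tgt j
      · rw [he, sub_self]
        exact hloop j he
      · exact ((h _ _ (ArcDigraph.arcGraph_adj.2
          ⟨he, Or.inl ⟨j, mem_univ j, rfl, rfl⟩⟩)).2 j).1 rfl rfl
    · intro h u v huv
      refine ⟨huv.ne, fun j => ⟨?_, ?_⟩⟩
      · rintro rfl rfl
        exact h j
      · rintro rfl rfl
        exact h j
  -- each solution comes from at most `|G| ^ (number of components)` potentials
  have hcount : ({p : Fin n → G | ∀ u v, K.Adj u v → Γ.Adj (u, p u) (v, p v)}.ncard : ℝ) <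
      δ * (Nat.card G : ℝ) ^ n := by
    rw [ncard_setOf_eq_card_filter, Nat.card_eq_fintype_card]
    let D : (Fin n → G) → Fin m → G := fun p j => p (H.tgt j) - p (H.src j)
    let P : Finset (Fin n → G) := {p | ∀ u v, K.Adj u v → Γ.Adj (u, p u) (v, p v)}
    have h1 : #P ≤ Fintype.card G ^ Nat.card K.ConnectedComponent * #(P.image D) := by
      refine card_le_mul_card_image _ _ fun x _ => ?_
      rw [← Nat.card_eq_fintype_card, ← Set.ncard_coe_finset]
      refine le_trans (Set.ncard_le_ncard (fun p hp => ?_) (Set.toFinite _))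
        (ArcDigraph.card_potentials_le (H := H) x)
      exact congrFun (mem_filter.1 (mem_coe.1 hp)).2
    have h2 : #(P.image D) ≤ (systemSolutions c A).ncard := by
      rw [← Set.ncard_coe_finset]
      refine Set.ncard_le_ncard ?_ (Set.toFinite _)
      intro x hx
      obtain ⟨p, hp, rfl⟩ := mem_image.1 (mem_coe.1 hx)
      exact ⟨(hG _).2 ⟨p, fun _ => rfl⟩, (hhom p).1 (mem_filter.1 hp).2⟩
    have h3 := ArcDigraph.add_card_connectedComponent_le c hQ
    rw [Nat.card_fin] at h3
    have h4 : (#P : ℝ) ≤ (Fintype.card G : ℝ) ^ Nat.card K.ConnectedComponent *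
        (systemSolutions c A).ncard := by
      exact_mod_cast h1.trans (Nat.mul_le_mul_left _ h2)
    calc (#P : ℝ) ≤ _ := h4
      _ < (Fintype.card G : ℝ) ^ Nat.card K.ConnectedComponent *
          (δ * (Fintype.card G : ℝ) ^ ((m : ℤ) - (k : ℤ))) := by gcongr
      _ = δ * (Fintype.card G : ℝ) ^
          ((Nat.card K.ConnectedComponent : ℤ) + ((m : ℤ) - (k : ℤ))) := by
        rw [zpow_add₀ (by positivity), zpow_natCast]
        ring
      _ ≤ δ * (Fintype.card G : ℝ) ^ (n : ℤ) := by
        gcongr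
        have h5 : m + Nat.card K.ConnectedComponent ≤ k + n := h3
        omega
      _ = δ * (Fintype.card G : ℝ) ^ n := by rw [zpow_natCast]
  obtain ⟨Γ', hΓ', hdel, hkill⟩ := hremoval Γ K hcount
  rw [ncard_setOf_eq_card_filter, Nat.card_eq_fintype_card] at hdel
  set Δ : Finset ((Fin n × G) × (Fin n × G)) := {z | Γ.Adj z.1 z.2 ∧ ¬ Γ'.Adj z.1 z.2} with hΔ
  -- keep the elements for which fewer than a `1 / m`-fraction of the edges were deleted
  let B : Fin m → G → Finset G := fun j a => {g | ((H.src j, g), (H.tgt j, g + a)) ∈ Δ}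
  refine ⟨fun j => {a | a ∈ A j ∧ m * #(B j a) < Fintype.card G}, fun j a ha => ha.1,
    fun j => ?_, ?_⟩
  · have h1 := card_heavy_translates_mul_le Δ (H.src j) (H.tgt j) m
    have h2 : (A j \ {a | a ∈ A j ∧ m * #(B j a) < Fintype.card G}).ncard ≤
        #{a : G | Fintype.card G ≤ m * #(B j a)} := by
      rw [← Set.ncard_coe_finset]
      refine Set.ncard_le_ncard ?_ (Set.toFinite _)
      rintro a ⟨ha, ha'⟩
      rw [coe_filter]
      exact ⟨mem_univ a, not_lt.1 fun h => ha' ⟨ha, h⟩⟩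
    have h3 : ((#{a : G | Fintype.card G ≤ m * #(B j a)} : ℕ) : ℝ) * Fintype.card G ≤ m * #Δ := by
      exact_mod_cast h1
    have h4 : (m : ℝ) * #Δ ≤ η * Fintype.card G * Fintype.card G := by
      calc (m : ℝ) * #Δ ≤ m * (η / m * (Fintype.card G : ℝ) ^ 2) := by gcongr
        _ = _ := by field_simp
    refine (Nat.cast_le.2 h2).trans ?_
    exact le_of_mul_le_mul_right (h3.trans h4) (by linarith)
  · rw [Set.eq_empty_iff_forall_notMem]
    rintro x ⟨hx, hxA⟩
    obtain ⟨p, hp⟩ := (hG x).1 hx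
    -- each translate of the potential `p` uses a deleted edge
    have hcover : (univ : Finset G) ⊆
        univ.biUnion fun j => (B j (x j)).image fun g => g - p (H.src j) := by
      intro t _
      obtain ⟨u, v, huv, hnot⟩ := hkill fun w => p w + t
      have hmemΔ : ∀ j, H.src j ≠ H.tgt j →
          ¬ Γ'.Adj (H.src j, p (H.src j) + t) (H.tgt j, p (H.tgt j) + t) →
          t ∈ univ.biUnion fun j => (B j (x j)).image fun g => g - p (H.src j) := by
        intro j hne hj
        refine mem_biUnion.2 ⟨j, mem_univ j, mem_image.2 ⟨p (H.src j) + t, ?_, by abel⟩⟩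
        have he : p (H.src j) + t + x j = p (H.tgt j) + t := by rw [hp j]; abel
        simp only [B, hΔ, mem_filter, mem_univ, true_and, he]
        refine ⟨?_, hj⟩
        refine (hhom fun w => p w + t).2 (fun i => ?_) _ _
          (ArcDigraph.arcGraph_adj.2 ⟨hne, Or.inl ⟨j, mem_univ j, rfl, rfl⟩⟩)
        have := (hxA i).1
        rw [hp i] at this
        simpa using this
      obtain ⟨hne, ⟨j, -, rfl, rfl⟩ | ⟨j, -, rfl, rfl⟩⟩ := ArcDigraph.arcGraph_adj.1 huv
      · exact hmemΔ j hne hnot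
      · exact hmemΔ j hne.symm fun h => hnot h.symm
    have h1 : Fintype.card G ≤ ∑ j, #(B j (x j)) := by
      rw [← card_univ]
      refine (card_le_card hcover).trans (card_biUnion_le.trans ?_)
      exact sum_le_sum fun j _ => card_image_le
    have h2 : ∑ j, m * #(B j (x j)) < ∑ _j : Fin m, Fintype.card G :=
      sum_lt_sum_of_nonempty ⟨⟨0, hm⟩, mem_univ _⟩ fun j _ => (hxA j).2
    rw [← mul_sum, sum_const, card_univ, Fintype.card_fin, smul_eq_mul] at h2
    exact absurd (Nat.mul_le_mul_left m h1) (not_le.2 h2)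

theorem theorem3 (m : ℕ) (hm : 2 ≤ m) (η : ℝ) (hη : 0 < η) :
    ∃ δ : ℝ, 0 < δ ∧
      ∀ (k : ℕ), 1 ≤ k →
      ∀ (c : Fin k → Fin m → ℤ), (∀ i j, c i j ∈ ({-1, 0, 1} : Set ℤ)) →
      GraphRepresentable c →
      ∀ (G : Type*) [AddCommGroup G] [Finite G] (A : Fin m → Set G),
        ((systemSolutions c A).ncard : ℝ) < δ * (Nat.card G : ℝ) ^ ((m : ℤ) - (k : ℤ)) →
        ∃ A' : Fin m → Set G,
          (∀ j, A' j ⊆ A j) ∧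
          (∀ j, ((A j \ A' j).ncard : ℝ) ≤ η * (Nat.card G : ℝ)) ∧
          systemSolutions c A' = ∅ := by
  have hm0 : 0 < m := by omega
  have hm' : (0 : ℝ) < m := by exact_mod_cast hm0
  obtain ⟨δ, hδ, hremoval⟩ :=
    exists_partite_graph_removal (n := 2 * m) (by omega) (div_pos hη hm')
  refine ⟨δ, hδ, ?_⟩
  rintro k - c - ⟨V, -, H, hH⟩ G _ _ A hfew
  obtain ⟨f, hf⟩ := H.exists_injOn_fin hm0
  let H' : ArcDigraph (Fin (2 * m)) m := ⟨f ∘ H.src, f ∘ H.tgt⟩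
  exact exists_subsets_without_solutions c H'
    (fun x hx => (ArcDigraph.exists_potential_comp_iff hf x).1
      ((hH.forall_sum_smul_eq_zero_iff x).1 hx))
    (fun x => (hH.forall_sum_smul_eq_zero_iff x).trans (ArcDigraph.exists_potential_comp_iff hf x))
    hm0 hδ hη (fun Γ K h => hremoval G Γ K h) A hfew
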